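/- Let $F$ be a field and let $D$ be a central division $F$-algebra of degree $d$, i.e. a division algebra with center $F$ and finite dimension $[D:F]=d^2$. Let $n$ be a positive integer and $A\in M_n(D)$. An element $\lambda\in D$ is called a right eigenvalue of $A$ if there is a nonzero column vector $v\in D^n$ with $Av=v\lambda$. For a maximal subfield $K$ of $D$, regard $D^n$ as a right $K$-vector space. Given an isomorphism of right $K$-vector spaces $g:D^n\to K^{nd}$, let $f(A)\in M_{nd}(K)$ be the matrix with $g(Av)=f(A)g(v)$ for all $v\in D^n$, and put $\Phi_A(z)=\det(f(A)-zI)\in K[z]$. Then maximal subfields $K$ exist; for every maximal subfield $K$ there is an isomorphism $g$ as above; the polynomial $\Phi_A(z)$ has its coefficients in $F$ and does not depend on the choice of $K$ and $g$; and for every $\lambda\in D$, $\lambda$ is a right eigenvalue of $A$ if and only if $\Phi_A(\lambda)=0$. -/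

import Mathlib

open scoped IsMulCommutative

/-- A maximal subfield of a division ring `D`: a commutative sub-division-ring that is maximal
under inclusion among the commutative ones. -/
def IsMaximalSubfield {D : Type*} [DivisionRing D] (K : Subfield D) : Prop :=
  Maximal (fun L : Subfield D => IsMulCommutative L) K

/-- `l` is a right eigenvalue of `A`: there is a nonzero column vector `v` with `A v = v l`. -/
def IsRightEigenvalue {D : Type*} [DivisionRing D] {n : ℕ}
    (A : Matrix (Fin n) (Fin n) D) (l : D) : Prop :=
  ∃ v : Fin n → D, v ≠ 0 ∧ A.mulVec v = fun i => v i * l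

/-- Isomorphisms `g : D ^ n → K ^ m` of right `K`-vector spaces, that is, additive bijections
with `g (v k) = g (v) k` for all `k` in `K`. -/
structure RightIso {D : Type*} [DivisionRing D] (K : Subfield D) (n m : ℕ) extends
    (Fin n → D) ≃+ (Fin m → K) where
  map_mul_right' : ∀ (v : Fin n → D) (k : K),
    toFun (fun i => v i * (k : D)) = fun j => toFun v j * k

/-- The matrix `f(A)` over `K` of the map `w ↦ g (A (g⁻¹ w))` on `K ^ m`; its `i`-th column is the
image of the `i`-th standard basis vector. -/
def RightIso.toMatrix {D : Type*} [DivisionRing D] {K : Subfield D} {n m : ℕ}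
    (g : RightIso K n m) (A : Matrix (Fin n) (Fin n) D) : Matrix (Fin m) (Fin m) K :=
  Matrix.of fun j i => g.toAddEquiv (A.mulVec (g.toAddEquiv.symm (Pi.single i 1))) j

/-- `f(A)` represents `A` in the coordinates `g`: `g (A v) = f(A) g(v)`. -/
theorem RightIso.toMatrix_mulVec {D : Type*} [DivisionRing D] {K : Subfield D}
    [IsMulCommutative K] {n m : ℕ} (g : RightIso K n m) (A : Matrix (Fin n) (Fin n) D)
    (v : Fin n → D) :
    (g.toMatrix A).mulVec (g.toAddEquiv v) = g.toAddEquiv (A.mulVec v) := by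
  have hg : ∀ (v : Fin n → D) (k : K),
      g.toAddEquiv (fun i => v i * (k : D)) = fun j => g.toAddEquiv v j * k := g.map_mul_right'
  have hA : ∀ (v : Fin n → D) (k : D), A.mulVec (fun i => v i * k) = fun i => A.mulVec v i * k := by
    intro v k
    funext i
    simp [Matrix.mulVec, dotProduct, Finset.sum_mul, mul_assoc]
  obtain ⟨w, rfl⟩ := g.toAddEquiv.symm.surjective v
  have hw : w = ∑ i, fun j => (Pi.single i 1 : Fin m → K) j * w i := by
    funext j
    simp [Finset.sum_apply, Pi.single_apply]
  have hs : ∀ (u : Fin m → K) (k : K),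
      g.toAddEquiv.symm (fun j => u j * k) = fun i => g.toAddEquiv.symm u i * (k : D) := by
    intro u k
    apply g.toAddEquiv.injective
    rw [hg]
    simp
  have hm : ∀ s : Fin m → Fin n → D, A.mulVec (∑ i, s i) = ∑ i, A.mulVec (s i) := by
    intro s
    exact map_sum (AddMonoidHom.mk' (fun v => A.mulVec v) (fun a b => Matrix.mulVec_add A a b)) s _
  rw [AddEquiv.apply_symm_apply]
  conv_rhs => rw [hw, map_sum, hm, map_sum]
  funext j
  simp only [hs, hA, hg, Finset.sum_apply]
  rfl

/-- The characteristic polynomial `det (f(A) - z I)` in `K[z]`. -/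
noncomputable def RightIso.charPoly {D : Type*} [DivisionRing D] {K : Subfield D}
    [IsMulCommutative K] {n m : ℕ} (g : RightIso K n m) (A : Matrix (Fin n) (Fin n) D) :
    Polynomial K :=
  ((g.toMatrix A).map (fun a => (Polynomial.C a : Polynomial K)) -
    (Polynomial.X : Polynomial K) • (1 : Matrix (Fin m) (Fin m) (Polynomial K))).det

/-! Let `χ` be the characteristic polynomial of `A` on `D ^ n` over `F`. A maximal subfield `K` is
its own centralizer, so the dimension formula gives `[K : F] = d`, and `K ⊗ D ^ n` is isomorphic to
`d` copies of the right `K`-space `D ^ n`, compatibly with `A`. Hence `χ`, read over `K`, is the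
`d`-th power of the characteristic polynomial over `K` (`charpoly_mulVecEnd_map`). Monic `d`-th
roots are unique by unique factorization, in every characteristic, so it remains to find a monic `P`
over `F` with `P ^ d = χ`.

For this, a separable self-centralizing subfield `S` is used. The root of `χ` over `S` has the same
image under all embeddings of `S` into an algebraic closure of `F`, so its coefficients lie in `F`.

Finally, every `l` lies in some maximal subfield `K`, over which a right eigenvalue in `K` is an
ordinary eigenvalue, that is, a root of `P`. -/

open scoped TensorProduct

/-! ### Sandwich operators and the double centralizer dimension formula -/

section CentralDivision

variable {F D : Type*} [Field F] [DivisionRing D] [Algebra F D]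

/-- Artin's short relation argument: linear independent right factors admit no nontrivial
relation `∑ a i * x * e i = 0` valid for all `x`. -/
theorem eq_zero_of_forall_sum_mul_mul_eq_zero [Algebra.IsCentral F D] {ι : Type*} [DecidableEq ι]
    {e : ι → D} (he : LinearIndependent F e) (s : Finset ι) :
    ∀ a : ι → D, (∀ x, ∑ i ∈ s, a i * x * e i = 0) → ∀ i ∈ s, a i = 0 := by
  induction s using Finset.strongInduction with
  | H s ih =>
    intro a ha
    by_contra! hne
    obtain ⟨k, hk, hak⟩ := hne
    -- Scale the `k`-th coefficient to `1`. The commutator with `y` kills it, leaving a shorter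
    -- relation, so the other scaled coefficients are central by induction.
    have hcomm : ∀ y, ∀ i ∈ s, y * ((a k)⁻¹ * a i) = (a k)⁻¹ * a i * y := by
      intro y i hi
      by_cases hik : i = k
      · subst hik; simp [hak]
      have hsum : ∀ x, ∑ i ∈ s, (y * ((a k)⁻¹ * a i) - (a k)⁻¹ * a i * y) * x * e i = 0 := by
        intro x
        have h1 : ∑ i ∈ s, y * (a k)⁻¹ * (a i * x * e i) = 0 := by
          rw [← Finset.mul_sum, ha, mul_zero]
        have h2 : ∑ i ∈ s, (a k)⁻¹ * (a i * (y * x) * e i) = 0 := by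
          rw [← Finset.mul_sum, ha, mul_zero]
        rw [← sub_eq_zero.2 (h1.trans h2.symm), ← Finset.sum_sub_distrib]
        refine Finset.sum_congr rfl fun i _ => ?_
        noncomm_ring
      have := ih (s.erase k) (Finset.erase_ssubset hk)
        (fun i => y * ((a k)⁻¹ * a i) - (a k)⁻¹ * a i * y) (fun x => by
          rw [← hsum x, ← Finset.add_sum_erase s _ hk]
          simp [hak]) i (Finset.mem_erase.2 ⟨hik, hi⟩)
      exact sub_eq_zero.1 this
    have hF : ∀ i, ∃ c : F, i ∈ s → algebraMap F D c = (a k)⁻¹ * a i := by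
      intro i
      by_cases hi : i ∈ s
      · have : (a k)⁻¹ * a i ∈ Subalgebra.center F D :=
          Subalgebra.mem_center_iff.2 fun y => hcomm y i hi
        rw [Algebra.IsCentral.center_eq_bot] at this
        obtain ⟨c, hc⟩ := Algebra.mem_bot.1 this
        exact ⟨c, fun _ => hc⟩
      · exact ⟨0, fun h => absurd h hi⟩
    choose c hc using hF
    -- At `x = 1` the scaled relation has coefficients in `F`, the `k`-th being `1`.
    have hrel : ∑ i ∈ s, c i • e i = 0 := by
      have h1 : ∑ i ∈ s, (a k)⁻¹ * (a i * 1 * e i) = 0 := by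
        rw [← Finset.mul_sum, ha, mul_zero]
      rw [← h1]
      refine Finset.sum_congr rfl fun i hi => ?_
      rw [Algebra.smul_def, hc i hi, mul_one, mul_assoc]
    have h0 := linearIndependent_iff'.1 he s c hrel k hk
    have h1 := hc k hk
    rw [h0, map_zero, inv_mul_cancel₀ hak] at h1
    exact zero_ne_one h1

/-- A family of linear forms on a left vector space with trivial common kernel contains one of
size the dimension whose common kernel is already trivial. -/
theorem exists_pi_injective_of_separating {X : Type*} (r : ℕ) :
    ∀ {W : Type*} [AddCommGroup W] [Module D W] [FiniteDimensional D W] (f : X → W →ₗ[D] D),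
      Module.finrank D W = r → (∀ w, (∀ x, f x w = 0) → w = 0) →
      ∃ b : Fin r → X, Function.Injective (LinearMap.pi fun i => f (b i)) := by
  induction r with
  | zero =>
    intro W _ _ _ f hr _
    have := Module.finrank_zero_iff.1 hr
    exact ⟨Fin.elim0, Function.injective_of_subsingleton _⟩
  | succ r ih =>
    intro W _ _ _ f hr hf
    have hW : Nontrivial W := Module.nontrivial_of_finrank_pos (R := D) (by omega)
    obtain ⟨w, hw⟩ := exists_ne (0 : W)
    obtain ⟨x, hx⟩ : ∃ x, f x w ≠ 0 := by
      by_contra! h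
      exact hw (hf w h)
    have hker : Module.finrank D (LinearMap.ker (f x)) = r := by
      have h1 := LinearMap.finrank_range_add_finrank_ker (f x)
      rw [LinearMap.range_eq_top.2 (LinearMap.surjective (fun h => hx (by simp [h]))),
        finrank_top, Module.finrank_self] at h1
      omega
    obtain ⟨b, hb⟩ := ih (fun y => (f y).domRestrict (LinearMap.ker (f x))) hker
      (fun v hv => Subtype.ext (hf v hv))
    refine ⟨Fin.cons x b, (injective_iff_map_eq_zero _).2 fun v hv => ?_⟩
    have hvx : f x v = 0 := congrFun hv 0
    have hv0 : (⟨v, hvx⟩ : LinearMap.ker (f x)) = 0 :=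
      hb (by
        rw [map_zero]
        funext i
        exact congrFun hv i.succ)
    exact congrArg Subtype.val hv0

variable {E : Type*} [Field E] [Algebra F E] (j : E →ₐ[F] D)

/-- The evaluation at `x` of the operators `y ↦ ∑ a * y * j e` attached to elements of
`D ⊗ E`. -/
noncomputable def sandwich (x : D) : D ⊗[F] E →ₗ[D] D :=
  TensorProduct.AlgebraTensorModule.lift
    ((LinearMap.toSpanSingleton D (E →ₗ[F] D) (LinearMap.mulLeft F x ∘ₗ j.toLinearMap)))

@[simp]
theorem sandwich_tmul (x a : D) (e : E) : sandwich j x (a ⊗ₜ e) = a * x * j e := by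
  simp [sandwich, mul_assoc]

/-- Expanding `t` in the left `D`-basis `1 ⊗ v i` turns the hypothesis into a relation of Artin's
type. -/
theorem eq_zero_of_forall_sandwich_eq_zero [Algebra.IsCentral F D] (t : D ⊗[F] E)
    (ht : ∀ x, sandwich j x t = 0) : t = 0 := by
  classical
  let v := Module.Basis.ofVectorSpace F E
  let w := v.baseChange D
  rw [← w.repr.map_eq_zero_iff]
  have he : LinearIndependent F fun i => j (v i) :=
    v.linearIndependent.map' j.toLinearMap (LinearMap.ker_eq_bot.2 j.toRingHom.injective)
  have hsum : t = ∑ i ∈ (w.repr t).support, w.repr t i • (1 : D) ⊗ₜ[F] v i := by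
    conv_lhs => rw [← w.linearCombination_repr t, Finsupp.linearCombination_apply, Finsupp.sum]
    simp [w]
  have key := eq_zero_of_forall_sum_mul_mul_eq_zero he (w.repr t).support (w.repr t) (fun x => by
    rw [← ht x]
    conv_rhs => rw [hsum]
    simp [mul_assoc])
  ext i
  by_contra h
  exact h (key i (Finsupp.mem_support_iff.2 h))

variable [Algebra.IsCentral F D] [FiniteDimensional F E]

/-- The sandwich evaluations separate points of `D ⊗ E`, so `[E : F]` of them already do, and then
dimensions agree. -/
theorem exists_sandwich_equiv : ∃ (b : Fin (Module.finrank F E) → D)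
    (Θ : D ⊗[F] E ≃ₗ[D] (Fin (Module.finrank F E) → D)), ∀ t i, Θ t i = sandwich j (b i) t := by
  have hr : Module.finrank D (D ⊗[F] E) = Module.finrank F E := Module.finrank_baseChange
  obtain ⟨b, hb⟩ := exists_pi_injective_of_separating _ (sandwich j) hr
    (eq_zero_of_forall_sandwich_eq_zero j)
  exact ⟨b, LinearEquiv.ofInjectiveOfFinrankEq _ hb (by simp [hr]), fun t i => rfl⟩

/-- The double centralizer dimension formula. -/
theorem finrank_mul_finrank_centralizer [FiniteDimensional F D] :
    Module.finrank F E * Module.finrank F (Subalgebra.centralizer F (Set.range j)) =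
      Module.finrank F D := by
  obtain ⟨b, Θ, hΘ⟩ := exists_sandwich_equiv j
  -- The basis dual to the evaluations at `b k`. The operators of the `u i` will be the coordinates
  -- of `D` over the centralizer, with right basis `b`.
  let u : Fin (Module.finrank F E) → D ⊗[F] E := fun i => Θ.symm (Pi.single i 1)
  have hu : ∀ i k, sandwich j (b k) (u i) = if k = i then 1 else 0 := by
    intro i k
    rw [← hΘ, LinearEquiv.apply_symm_apply, Pi.single_apply]
  have hmul : ∀ (x : D) (e : E) (t : D ⊗[F] E),
      sandwich j x (TensorProduct.map LinearMap.id (LinearMap.mulRight F e) t) =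
        sandwich j x t * j e := by
    intro x e t
    induction t with
    | zero => simp
    | tmul a e' => simp [mul_assoc]
    | add t t' h h' => simp [h, h', add_mul]
  have hcomm : ∀ e i, TensorProduct.map LinearMap.id (LinearMap.mulRight F e) (u i) =
      j e • u i := by
    intro e i
    apply Θ.injective
    funext k
    rw [map_smul, Pi.smul_apply, hΘ, hΘ, hmul, hu]
    split_ifs <;> simp
  have hmem : ∀ x i, sandwich j x (u i) ∈ Subalgebra.centralizer F (Set.range j) := by
    rintro x i _ ⟨e, rfl⟩
    rw [← hmul, hcomm, map_smul, smul_eq_mul]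
  -- Evaluated at `x`, this is the expansion of `x` in the basis `b`.
  have hone : ∑ i, b i • u i = 1 ⊗ₜ[F] 1 := by
    apply Θ.injective
    funext k
    rw [map_sum, Finset.sum_apply]
    simp [hΘ, hu]
  have hlin : ∀ (x c : D), c ∈ Subalgebra.centralizer F (Set.range j) → ∀ t,
      sandwich j (x * c) t = sandwich j x t * c := by
    intro x c hc t
    induction t with
    | zero => simp
    | tmul a e =>
      have := hc (j e) ⟨e, rfl⟩
      simp [mul_assoc, this]
    | add t t' h h' => simp [h, h', add_mul]
  have hadd : ∀ t, ∀ (x y : D), sandwich j (x + y) t = sandwich j x t + sandwich j y t := by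
    intro t x y
    induction t with
    | zero => simp
    | tmul a e => simp [mul_add, add_mul]
    | add t t' h h' => simp only [map_add, h, h']; abel
  let S : (Fin (Module.finrank F E) → Subalgebra.centralizer F (Set.range j)) →ₗ[F] D :=
    ∑ i, LinearMap.mulLeft F (b i) ∘ₗ (Subalgebra.val _).toLinearMap ∘ₗ LinearMap.proj i
  have hS : ∀ c, S c = ∑ i, b i * (c i : D) := fun c => by simp [S]
  have hbij : Function.Bijective S := by
    constructor
    · refine (injective_iff_map_eq_zero S).2 fun c hc => ?_
      funext k
      have h1 : sandwich j (S c) (u k) = c k := by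
        have : sandwich j (S c) (u k) = ∑ i, sandwich j (b i * (c i : D)) (u k) := by
          rw [hS]
          exact map_sum (AddMonoidHom.mk' (fun x => sandwich j x (u k)) (hadd (u k))) _ _
        rw [this]
        simp [hlin _ _ (c _).2, hu]
      have h2 : sandwich j 0 (u k) = 0 := by
        simpa using hadd (u k) 0 0
      rw [hc, h2] at h1
      exact Subtype.ext h1.symm
    · intro x
      refine ⟨fun i => ⟨sandwich j x (u i), hmem x i⟩, ?_⟩
      rw [hS]
      have := congrArg (sandwich j x) hone
      simpa using this
  rw [← (LinearEquiv.ofBijective S hbij).finrank_eq]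
  simp [Module.finrank_pi_fintype]

end CentralDivision

/-! ### Right vector spaces as left modules -/

section RightScalar

variable {F D : Type*} [Field F] [DivisionRing D] [Algebra F D]
variable {E : Type*} [Field E] [Algebra F E] (j : E →ₐ[F] D)

/-- `D` as a right vector space over a field `E` mapping to it. -/
@[nolint unusedArguments]
def RightScalar (_ : E →ₐ[F] D) : Type _ := D

namespace RightScalar

instance : AddCommGroup (RightScalar j) := inferInstanceAs (AddCommGroup D)

instance : Module F (RightScalar j) := inferInstanceAs (Module F D)

instance [FiniteDimensional F D] : FiniteDimensional F (RightScalar j) :=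
  inferInstanceAs (FiniteDimensional F D)

/-- The identity map, as an `F`-linear equivalence. -/
def toD : RightScalar j ≃ₗ[F] D := LinearEquiv.refl F D

/-- Since `E` is commutative, right multiplication is also a left action, so ordinary linear algebra
over `E` applies. -/
instance : Module E (RightScalar j) where
  smul e x := (toD j).symm (toD j x * j e)
  one_smul x := by
    show (toD j).symm (toD j x * j 1) = x
    simp
  mul_smul e e' x := by
    show (toD j).symm (toD j x * j (e * e')) = (toD j).symm (toD j x * j e' * j e)
    rw [mul_comm e, map_mul j, ← mul_assoc]
  smul_zero e := by
    show (toD j).symm (toD j 0 * j e) = 0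
    simp
  smul_add e x y := by
    show (toD j).symm (toD j (x + y) * j e) =
      (toD j).symm (toD j x * j e) + (toD j).symm (toD j y * j e)
    rw [map_add, add_mul, map_add]
  add_smul e e' x := by
    show (toD j).symm (toD j x * j (e + e')) =
      (toD j).symm (toD j x * j e) + (toD j).symm (toD j x * j e')
    rw [map_add, mul_add, map_add]
  zero_smul x := by
    show (toD j).symm (toD j x * j 0) = 0
    simp

@[simp]
theorem toD_smul (e : E) (x : RightScalar j) : toD j (e • x) = toD j x * j e := rfl

instance : IsScalarTower F E (RightScalar j) where
  smul_assoc c e x := (toD j).injective (by simp)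

instance [FiniteDimensional F D] : FiniteDimensional E (RightScalar j) :=
  FiniteDimensional.right F E _

/-- Left multiplication by a matrix over `D` on column vectors, as a map of right vector spaces
over `E`. -/
def matrixEnd {n : ℕ} (A : Matrix (Fin n) (Fin n) D) : Module.End E (Fin n → RightScalar j) where
  toFun v i := (toD j).symm (A.mulVec (fun k => toD j (v k)) i)
  map_add' v w := by
    funext i
    apply (toD j).injective
    simp [Matrix.mulVec, dotProduct, mul_add, Finset.sum_add_distrib]
  map_smul' e v := by
    funext i
    apply (toD j).injective
    simp [Matrix.mulVec, dotProduct, Finset.sum_mul, mul_assoc]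

@[simp]
theorem toD_matrixEnd {n : ℕ} (A : Matrix (Fin n) (Fin n) D) (v : Fin n → RightScalar j)
    (i : Fin n) : toD j (matrixEnd j A v i) = A.mulVec (fun k => toD j (v k)) i := rfl

end RightScalar

end RightScalar

/-! ### Dimensions over a self-centralizing subfield -/

section SelfCentralizing

variable {F D : Type*} [Field F] [DivisionRing D] [Algebra F D] [Algebra.IsCentral F D]
  [FiniteDimensional F D] {E : Type*} [Field E] [Algebra F E] [FiniteDimensional F E]
  (j : E →ₐ[F] D) {d : ℕ} (hd : Module.finrank F D = d ^ 2)
  (hE : Subalgebra.centralizer F (Set.range j) = j.range)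

include hd hE

theorem finrank_of_centralizer_eq_range : Module.finrank F E = d := by
  have h := finrank_mul_finrank_centralizer j
  rw [hE, hd, ← (AlgEquiv.ofInjectiveField j).toLinearEquiv.finrank_eq, ← sq] at h
  exact Nat.pow_left_injective two_ne_zero h

theorem finrank_rightScalar : Module.finrank E (RightScalar j) = d := by
  have h := Module.finrank_mul_finrank F E (RightScalar j)
  have hE' := finrank_of_centralizer_eq_range j hd hE
  have hD : Module.finrank F (RightScalar j) = d ^ 2 := hd
  have hpos : 0 < Module.finrank F E := Module.finrank_pos
  rw [hE'] at h hpos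
  rw [hD, sq] at h
  exact Nat.eq_of_mul_eq_mul_left hpos h

theorem finrank_pi_rightScalar (n : ℕ) : Module.finrank E (Fin n → RightScalar j) = n * d := by
  rw [Module.finrank_pi_fintype, Finset.sum_const, finrank_rightScalar j hd hE]
  simp

end SelfCentralizing

/-! ### Characteristic polynomials over the centre and over a subfield -/

section Charpoly

theorem LinearMap.charpoly_compLeft_fin {R M : Type*} [CommRing R] [AddCommGroup M]
    [Module R M] [Module.Finite R M] [Module.Free R M] (f : Module.End R M) (m : ℕ) :
    LinearMap.charpoly (f.compLeft (Fin m) : Module.End R (Fin m → M)) =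
      LinearMap.charpoly f ^ m := by
  nontriviality R
  induction m with
  | zero =>
    rw [pow_zero, ← Polynomial.Monic.natDegree_eq_zero (LinearMap.charpoly_monic _),
      LinearMap.charpoly_natDegree]
    exact Module.finrank_zero_of_subsingleton
  | succ m ih =>
    have h : (f.compLeft (Fin (m + 1)) : Module.End R (Fin (m + 1) → M)) =
        (Fin.consLinearEquiv R (fun _ : Fin (m + 1) => M)).conj
          (f.prodMap (f.compLeft (Fin m))) := by
      refine LinearMap.ext fun v => ?_
      funext i
      refine Fin.cases ?_ (fun i => ?_) i <;> simp [LinearEquiv.conj_apply] <;> rfl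
    rw [h, LinearEquiv.charpoly_conj, LinearMap.charpoly_prodMap, ih, pow_succ']

/-- Monic polynomials over a field are determined by any positive power. -/
theorem Polynomial.Monic.eq_of_pow_eq_pow {E : Type*} [Field E] {p q : Polynomial E}
    (hp : p.Monic) (hq : q.Monic) {d : ℕ} (hd : d ≠ 0) (h : p ^ d = q ^ d) : p = q :=
  Polynomial.eq_of_monic_of_associated hp hq <| associated_of_dvd_dvd
    ((UniqueFactorizationMonoid.pow_dvd_pow_iff_dvd hd).1 h.dvd) ((UniqueFactorizationMonoid.pow_dvd_pow_iff_dvd hd).1 h.symm.dvd)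

variable (F : Type*) {D : Type*} [Field F] [DivisionRing D] [Algebra F D]

/-- Left multiplication by a matrix on column vectors, as an `F`-linear map. -/
def Matrix.mulVecEnd {n : ℕ} (A : Matrix (Fin n) (Fin n) D) : Module.End F (Fin n → D) where
  toFun v := A.mulVec v
  map_add' v w := Matrix.mulVec_add A v w
  map_smul' c v := Matrix.mulVec_smul A c v

variable {F} {E : Type*} [Field E] [Algebra F E] (j : E →ₐ[F] D)

open RightScalar

/-- The map `E ⊗ D ^ n → (D ^ n) ^ m`, `e ⊗ v ↦ (v * b i * e)` attached to a family `b`. -/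
noncomputable def baseChangePi {m : ℕ} (b : Fin m → D) (n : ℕ) :
    E ⊗[F] (Fin n → D) →ₗ[E] (Fin m → Fin n → RightScalar j) :=
  LinearMap.liftBaseChange E <| LinearMap.pi fun i => LinearMap.pi fun k =>
    (toD j).symm.toLinearMap ∘ₗ LinearMap.mulRight F (b i) ∘ₗ LinearMap.proj k

theorem toD_baseChangePi_tmul {m : ℕ} (b : Fin m → D) (n : ℕ) (e : E) (v : Fin n → D)
    (i : Fin m) (k : Fin n) :
    toD j (baseChangePi j b n (e ⊗ₜ v) i k) = v k * b i * j e := by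
  simp [baseChangePi]

/-- After swapping tensor factors, each coordinate `k` of the map is `Θ`, so preimages can be taken
coordinatewise and summed. -/
theorem baseChangePi_surjective {m : ℕ} (b : Fin m → D) (n : ℕ)
    (Θ : D ⊗[F] E ≃ₗ[D] (Fin m → D)) (hΘ : ∀ t i, Θ t i = sandwich j (b i) t) :
    Function.Surjective (baseChangePi j b n) := by
  have key : ∀ (k : Fin n) (t : D ⊗[F] E) (i : Fin m) (k' : Fin n),
      toD j (baseChangePi j b n (TensorProduct.map LinearMap.id
        (LinearMap.single F (fun _ : Fin n => D) k) (TensorProduct.comm F D E t)) i k') =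
      if k' = k then Θ t i else 0 := by
    intro k t i k'
    rw [hΘ]
    induction t with
    | zero => simp
    | tmul a e =>
      rw [TensorProduct.comm_tmul, TensorProduct.map_tmul, toD_baseChangePi_tmul]
      by_cases h : k' = k
      · subst h; simp
      · simp [h]
    | add t t' h h' =>
      simp only [map_add, Pi.add_apply, h, h']
      split_ifs <;> simp
  intro w
  refine ⟨∑ k, TensorProduct.map LinearMap.id (LinearMap.single F (fun _ : Fin n => D) k)
    (TensorProduct.comm F D E (Θ.symm fun i => toD j (w i k))), ?_⟩
  funext i k
  apply (toD j).injective
  simp only [map_sum, Finset.sum_apply, key, LinearEquiv.apply_symm_apply]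
  simp

variable [Algebra.IsCentral F D] [FiniteDimensional F D] [FiniteDimensional F E]
  {d : ℕ} (hd : Module.finrank F D = d ^ 2)
  (hE : Subalgebra.centralizer F (Set.range j) = j.range)

include hd hE

/-- Over a self-centralizing subfield, the characteristic polynomial of `A` acting on `D ^ n` over
the centre is the `d`-th power of the one over the subfield. -/
theorem charpoly_mulVecEnd_map {n : ℕ} (A : Matrix (Fin n) (Fin n) D) :
    (A.mulVecEnd F).charpoly.map (algebraMap F E) = (matrixEnd j A).charpoly ^ d := by
  obtain ⟨b, Θ, hΘ⟩ := exists_sandwich_equiv j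
  rw [← LinearMap.charpoly_baseChange,
    ← finrank_of_centralizer_eq_range j hd hE, ← LinearMap.charpoly_compLeft_fin]
  -- Both dimensions are `n * d ^ 2`, so surjectivity suffices for bijectivity.
  have hdim : Module.finrank E (E ⊗[F] (Fin n → D)) =
      Module.finrank E (Fin (Module.finrank F E) → Fin n → RightScalar j) := by
    rw [Module.finrank_baseChange, Module.finrank_pi_fintype, Module.finrank_pi_fintype]
    simp only [finrank_pi_rightScalar j hd hE, finrank_of_centralizer_eq_range j hd hE, hd,
      Finset.sum_const, Finset.card_univ, Fintype.card_fin, smul_eq_mul]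
    ring
  let e := LinearEquiv.ofBijective (baseChangePi j b n)
    ⟨(LinearMap.injective_iff_surjective_of_finrank_eq_finrank hdim).2
      (baseChangePi_surjective j b n Θ hΘ), baseChangePi_surjective j b n Θ hΘ⟩
  have hint : ∀ t, baseChangePi j b n ((A.mulVecEnd F).baseChange E t) =
      (matrixEnd j A).compLeft (Fin _) (baseChangePi j b n t) := by
    intro t
    induction t with
    | zero => simp
    | add t t' h h' => simp only [map_add, h, h']
    | tmul c v =>
      funext i k
      apply (toD j).injective
      rw [LinearMap.baseChange_tmul, toD_baseChangePi_tmul, LinearMap.compLeft_apply,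
        Function.comp_apply, toD_matrixEnd]
      simp only [toD_baseChangePi_tmul]
      show (∑ l, A k l * v l) * b i * j c = ∑ l, A k l * (v l * b i * j c)
      simp [Finset.sum_mul, mul_assoc]
  rw [← e.charpoly_conj]
  congr 1
  refine LinearMap.ext fun w => ?_
  obtain ⟨t, rfl⟩ := e.surjective w
  rw [LinearEquiv.conj_apply]
  rw [LinearMap.comp_apply, LinearMap.comp_apply, LinearEquiv.coe_coe, LinearEquiv.coe_coe,
    LinearEquiv.symm_apply_apply]
  exact hint t

end Charpoly

/-! ### A separable self-centralizing subfield -/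

section SeparableSubalgebra

/-- A division ring that is radical over its centre is commutative. -/
theorem mul_comm_of_forall_pow_mem_center {C : Type*} [DivisionRing C] (q : ℕ) [ExpChar C q]
    (h : ∀ x : C, ∃ n : ℕ, x ^ q ^ n ∈ Subring.center C) (x y : C) : x * y = y * x := by
  have hq : ExpChar (Subring.center C) q := ExpChar.expChar_center_iff.2 ‹_›
  have hpure : IsPurelyInseparable (Subring.center C) C := by
    rw [isPurelyInseparable_iff_pow_mem _ q]
    intro x
    obtain ⟨n, hn⟩ := h x
    exact ⟨n, ⟨_, hn⟩, rfl⟩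
  -- By Jacobson–Noether, otherwise some noncentral element is separable over the centre,
  -- contradicting pure inseparability.
  have htop : Subring.center C = ⊤ := by
    by_contra hne
    obtain ⟨x, hx, hsep⟩ := JacobsonNoether.exists_separable_and_not_isCentral C hne
    obtain ⟨z, rfl⟩ := hpure.inseparable' x hsep
    exact hx z.2
  have hx : y ∈ Subring.center C := htop ▸ Subring.mem_top y
  exact Subring.mem_center_iff.1 hx x

variable {F D : Type*} [Field F] [DivisionRing D] [Algebra F D] [FiniteDimensional F D]

theorem Subalgebra.finrank_mul_finrank_centralizer [Algebra.IsCentral F D] (S : Subalgebra F D)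
    [IsMulCommutative S] :
    Module.finrank F S * Module.finrank F (Subalgebra.centralizer F (S : Set D)) =
      Module.finrank F D := by
  let _ : Field S := fieldOfFiniteDimensional F S
  have h := _root_.finrank_mul_finrank_centralizer S.val
  have hr : Set.range S.val = (S : Set D) := by simp
  rwa [hr] at h

/-- The field generated by `S` and `x` is purely inseparable over its separable part, which contains
`S` and so equals it by maximality. -/
theorem exists_pow_mem_of_maximal_separable {S : Subalgebra F D}
    (hS : Maximal (fun T : Subalgebra F D => (∀ x ∈ T, ∀ y ∈ T, x * y = y * x) ∧
      ∀ x ∈ T, IsSeparable F x) S) (q : ℕ) [ExpChar F q] {x : D}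
    (hx : x ∈ Subalgebra.centralizer F (S : Set D)) : ∃ n : ℕ, x ^ q ^ n ∈ S := by
  have hL : IsMulCommutative (Algebra.adjoin F (insert x (S : Set D))) := by
    refine Algebra.isMulCommutative_adjoin F ?_
    rintro a (rfl | ha) b (rfl | hb)
    · rfl
    · exact (hx b hb).symm
    · exact hx a ha
    · exact hS.prop.1 a ha b hb
  set L := Algebra.adjoin F (insert x (S : Set D)) with hLdef
  have hSL : (S : Set D) ⊆ L := (Set.subset_insert _ _).trans Algebra.subset_adjoin
  have hxL : x ∈ L := Algebra.subset_adjoin (Set.mem_insert _ _)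
  let _ : Field L := fieldOfFiniteDimensional F L
  have hq : ExpChar (separableClosure F L) q :=
    expChar_of_injective_algebraMap (algebraMap F (separableClosure F L)).injective q
  obtain ⟨n, y, hy⟩ := IsPurelyInseparable.pow_mem (separableClosure F L) q (⟨x, hxL⟩ : L)
  refine ⟨n, ?_⟩
  have hsep : ∀ z : L, IsSeparable F z ↔ IsSeparable F (z : D) := fun z => by
    have h := minpoly.algHom_eq L.val Subtype.val_injective z
    unfold IsSeparable
    rw [← h]
    rfl
  have hle : S ≤ (separableClosure F L).toSubalgebra.map L.val := by
    intro s hs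
    refine ⟨⟨s, hSL hs⟩, ?_, rfl⟩
    exact mem_separableClosure_iff.2 ((hsep _).2 (hS.prop.2 s hs))
  have hT := hS.le_of_ge (y := (separableClosure F L).toSubalgebra.map L.val) ⟨?_, ?_⟩ hle
  · refine hT ⟨_, y.2, ?_⟩
    exact congrArg L.val hy
  · rintro _ ⟨a, -, rfl⟩ _ ⟨b, -, rfl⟩
    exact congrArg L.val (mul_comm a b)
  · rintro _ ⟨a, ha, rfl⟩
    exact (hsep a).1 (mem_separableClosure_iff.1 ha)

/-- A central division algebra contains a self-centralizing separable subfield. -/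
theorem exists_separable_self_centralizing [Algebra.IsCentral F D] {d : ℕ}
    (hd : Module.finrank F D = d ^ 2) : ∃ S : Subalgebra F D, IsMulCommutative S ∧
      Subalgebra.centralizer F (S : Set D) = S ∧ ∀ x ∈ S, IsSeparable F x := by
  have hwf : WellFoundedGT (Subalgebra F D) :=
    StrictMono.wellFoundedGT (f := (Subalgebra.toSubmodule : Subalgebra F D → Submodule F D))
      (OrderEmbedding.strictMono _)
  obtain ⟨S, hS⟩ : ∃ S, Maximal (fun T : Subalgebra F D => (∀ x ∈ T, ∀ y ∈ T, x * y = y * x) ∧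
      ∀ x ∈ T, IsSeparable F x) S := by
    obtain ⟨S, hS, hmax⟩ := hwf.wf.has_min {T : Subalgebra F D |
      (∀ x ∈ T, ∀ y ∈ T, x * y = y * x) ∧ ∀ x ∈ T, IsSeparable F x} ⟨⊥, by
        constructor
        · rintro _ ⟨a, rfl⟩ y -
          exact Algebra.commutes a y
        · rintro _ ⟨a, rfl⟩
          exact isSeparable_algebraMap a⟩
    refine ⟨S, hS, fun T hT hle => ?_⟩
    by_contra hn
    exact hmax T hT (lt_of_le_not_ge hle hn)
  have hScomm : IsMulCommutative S := ⟨⟨fun x y => Subtype.ext (hS.prop.1 x x.2 y y.2)⟩⟩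
  refine ⟨S, hScomm, ?_, hS.prop.2⟩
  have hSC : S ≤ Subalgebra.centralizer F (S : Set D) := fun x hx y hy => hS.prop.1 y hy x hx
  set C := Subalgebra.centralizer F (S : Set D) with hC
  obtain ⟨q, hq⟩ := ExpChar.exists F
  let _ : DivisionRing C := divisionRingOfFiniteDimensional F C
  have hqC : ExpChar C q := expChar_of_injective_algebraMap (algebraMap F C).injective q
  -- `C` is radical over `S`, which is central in `C`.
  have hCcomm : IsMulCommutative C := by
    refine ⟨⟨mul_comm_of_forall_pow_mem_center q fun x => ?_⟩⟩
    obtain ⟨n, hn⟩ := exists_pow_mem_of_maximal_separable hS q x.2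
    exact ⟨n, Subring.mem_center_iff.2 fun y => Subtype.ext (y.2 _ hn).symm⟩
  -- The dimension formula for `C` gives `[C : F] = d`; for `S` it then gives `[S : F] = d`, so `S =
  -- C`.
  have hCC : Subalgebra.centralizer F (C : Set D) = C := by
    refine le_antisymm (fun x hx y hy => hx y (hSC hy)) fun x hx y hy => ?_
    exact congrArg Subtype.val (mul_comm (⟨y, hy⟩ : C) ⟨x, hx⟩)
  have h1 := C.finrank_mul_finrank_centralizer
  have h2 := S.finrank_mul_finrank_centralizer
  rw [hCC, ← sq, hd] at h1
  have h3 : Module.finrank F C = d := Nat.pow_left_injective two_ne_zero h1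
  rw [← hC, h3, hd, sq] at h2
  have hpos : 0 < d := h3 ▸ Module.finrank_pos
  exact (Subalgebra.eq_of_le_of_finrank_eq hSC
    ((Nat.eq_of_mul_eq_mul_right hpos h2).trans h3.symm)).symm

end SeparableSubalgebra

/-! ### Descent of the `d`-th root to the centre -/

section Descent

/-- An element of a separable extension with the same image under all embeddings into an
algebraically closed field lies in the base field. -/
theorem mem_range_algebraMap_of_forall_algHom_eq {F E Ω : Type*} [Field F] [Field E] [Field Ω]
    [Algebra F E] [Algebra F Ω] [IsAlgClosed Ω] [Algebra.IsAlgebraic F E] {c : E}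
    (hc : IsSeparable F c) (h : ∀ σ τ : E →ₐ[F] Ω, σ c = τ c) : c ∈ (algebraMap F E).range := by
  -- By separability the degree counts the roots, which are the images of `c` under the embeddings.
  rw [← minpoly.natDegree_eq_one_iff]
  have hcard := Polynomial.card_rootSet_eq_natDegree (K := Ω) hc (IsAlgClosed.splits _)
  refine le_antisymm ?_ (minpoly.natDegree_pos (Algebra.IsIntegral.isIntegral c))
  rw [← hcard, Fintype.card_le_one_iff_subsingleton, Set.subsingleton_coe,
    ← Algebra.IsAlgebraic.range_eval_eq_rootSet_minpoly]
  rintro _ ⟨σ, rfl⟩ _ ⟨τ, rfl⟩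
  exact h σ τ

variable {F D : Type*} [Field F] [DivisionRing D] [Algebra F D] [FiniteDimensional F D]
  [Algebra.IsCentral F D] {d : ℕ} (hd : Module.finrank F D = d ^ 2) (hd0 : d ≠ 0)

include hd hd0

/-- The reduced characteristic polynomial: the characteristic polynomial of `A` acting on `D ^ n`
over the centre is a `d`-th power of a monic polynomial over the centre. -/
theorem exists_monic_pow_eq_charpoly_mulVecEnd {n : ℕ} (A : Matrix (Fin n) (Fin n) D) :
    ∃ P : Polynomial F, P.Monic ∧ P ^ d = (A.mulVecEnd F).charpoly := by
  obtain ⟨S, _, hSS, hsep⟩ := exists_separable_self_centralizing hd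
  let _ : Field S := fieldOfFiniteDimensional F S
  have hE : Subalgebra.centralizer F (Set.range S.val) = S.val.range := by
    have hr : Set.range S.val = (S : Set D) := by simp
    rw [hr, hSS, S.range_val]
  have key := charpoly_mulVecEnd_map S.val hd hE A
  set Q := (RightScalar.matrixEnd S.val A).charpoly with hQ
  have hQm : Q.Monic := LinearMap.charpoly_monic _
  -- Both images are monic `d`-th roots of the same polynomial coming from `F`.
  have hσ : ∀ σ τ : S →ₐ[F] AlgebraicClosure F,
      Q.map (σ : S →+* AlgebraicClosure F) = Q.map (τ : S →+* AlgebraicClosure F) := by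
    intro σ τ
    refine (hQm.map _).eq_of_pow_eq_pow (hQm.map _) hd0 ?_
    rw [← Polynomial.map_pow, ← Polynomial.map_pow, ← key, Polynomial.map_map, Polynomial.map_map,
      σ.comp_algebraMap, τ.comp_algebraMap]
  have hlift : Q ∈ Polynomial.lifts (algebraMap F S) := by
    rw [Polynomial.lifts_iff_coeff_lifts]
    intro i
    refine mem_range_algebraMap_of_forall_algHom_eq (Ω := AlgebraicClosure F) ?_ fun σ τ => ?_
    · have h := minpoly.algHom_eq S.val Subtype.val_injective (Q.coeff i)
      have h' := hsep _ (Q.coeff i).2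
      unfold IsSeparable at h' ⊢
      rw [← h]
      exact h'
    · simpa using congrArg (fun R => Polynomial.coeff R i) (hσ σ τ)
  obtain ⟨P, hP, -, hPm⟩ := Polynomial.lifts_and_natDegree_eq_and_monic hlift hQm
  refine ⟨P, hPm, Polynomial.map_injective _ (algebraMap F S).injective ?_⟩
  rw [Polynomial.map_pow, hP, key]

end Descent

/-! ### Maximal subfields, coordinates and eigenvalues -/

section MaximalSubfield

variable {D : Type*} [DivisionRing D]

theorem Subfield.isMulCommutative_closure {s : Set D} (hs : ∀ x ∈ s, ∀ y ∈ s, x * y = y * x) :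
    IsMulCommutative (Subfield.closure s) := by
  have h1 : ∀ x ∈ Subfield.closure s, ∀ y ∈ s, Commute x y := by
    intro x hx y hy
    induction hx using Subfield.closure_induction with
    | mem x hx => exact hs x hx y hy
    | one => exact Commute.one_left y
    | add _ _ _ _ h h' => exact h.add_left h'
    | neg _ _ h => exact h.neg_left
    | inv _ _ h => exact h.inv_left₀
    | mul _ _ _ _ h h' => exact h.mul_left h'
  refine ⟨⟨fun x y => Subtype.ext ?_⟩⟩
  obtain ⟨x, hx⟩ := x
  obtain ⟨y, hy⟩ := y
  show Commute x y
  induction hy using Subfield.closure_induction with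
  | mem y hy => exact h1 x hx y hy
  | one => exact Commute.one_right x
  | add _ _ _ _ h h' => exact h.add_right h'
  | neg _ _ h => exact h.neg_right
  | inv _ _ h => exact h.inv_right₀
  | mul _ _ _ _ h h' => exact h.mul_right h'

theorem IsMaximalSubfield.mem_of_commute {K : Subfield D} (hK : IsMaximalSubfield K) {x : D}
    (hx : ∀ k ∈ K, k * x = x * k) : x ∈ K := by
  have := hK.prop
  have hc : IsMulCommutative (Subfield.closure (insert x (K : Set D))) := by
    refine Subfield.isMulCommutative_closure ?_
    rintro a (rfl | ha) b (rfl | hb)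
    · rfl
    · exact (hx b hb).symm
    · exact hx a ha
    · exact setLike_mul_comm ha hb
  exact hK.le_of_ge hc ((Set.subset_insert _ _).trans Subfield.subset_closure)
    (Subfield.subset_closure (Set.mem_insert _ _))

/-- Zorn's lemma above the subfield generated by `l`: the supremum of a chain of commutative
subfields is commutative. -/
theorem exists_isMaximalSubfield_mem (l : D) : ∃ K : Subfield D, IsMaximalSubfield K ∧ l ∈ K := by
  obtain ⟨K, hle, hK⟩ := zorn_le_nonempty₀ {K : Subfield D | IsMulCommutative K}
    (fun c hc hchain y hy => by
      refine ⟨sSup c, ⟨⟨fun a b => Subtype.ext ?_⟩⟩, fun z hz => le_sSup hz⟩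
      obtain ⟨s, hs, ha⟩ := (Subfield.mem_sSup_of_directedOn ⟨y, hy⟩ hchain.directedOn).1 a.2
      obtain ⟨t, ht, hb⟩ := (Subfield.mem_sSup_of_directedOn ⟨y, hy⟩ hchain.directedOn).1 b.2
      rcases hchain.total hs ht with h | h
      · have : IsMulCommutative t := hc ht
        exact setLike_mul_comm (h ha) hb
      · have : IsMulCommutative s := hc hs
        exact setLike_mul_comm ha (h hb))
    (Subfield.closure {l})
    (Subfield.isMulCommutative_closure (by rintro _ rfl _ rfl; rfl))
  exact ⟨K, hK, hle (Subfield.subset_closure rfl)⟩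

/-- The field structure on a commutative sub-division-ring. -/
@[reducible]
def Subfield.fieldOfIsMulCommutative (K : Subfield D) [IsMulCommutative K] : Field K :=
  { (inferInstance : DivisionRing K), (inferInstance : CommRing K) with }

attribute [local instance] Subfield.fieldOfIsMulCommutative

variable {F : Type*} [Field F] [Algebra F D]

/-- A maximal subfield contains the centre. -/
theorem IsMaximalSubfield.algebraMap_mem {K : Subfield D} (hK : IsMaximalSubfield K) (c : F) :
    algebraMap F D c ∈ K :=
  hK.mem_of_commute fun k _ => (Algebra.commutes c k).symm

variable {K : Subfield D} [IsMulCommutative K]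

open RightScalar

section Coordinates

variable [Algebra F K] (j : K →ₐ[F] D) (hj : ∀ k, j k = k)

/-- Coordinates on the right `K`-space `D ^ n` from a linear equivalence. -/
def RightIso.ofLinearEquiv {n m : ℕ} (e : (Fin n → RightScalar j) ≃ₗ[K] (Fin m → K)) :
    RightIso K n m where
  toFun v := e fun i => (toD j).symm (v i)
  invFun w i := toD j (e.symm w i)
  left_inv v := by simp
  right_inv w := by simp
  map_add' v w := by
    rw [← map_add]
    congr 1
  map_mul_right' v k := by
    have h : (fun i => (toD j).symm (v i * (k : D))) = k • fun i => (toD j).symm (v i) := by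
      funext i
      apply (toD j).injective
      simp [hj]
    show e (fun i => (toD j).symm (v i * (k : D))) = _
    rw [h, map_smul]
    funext i
    exact mul_comm _ _

/-- The linear equivalence underlying coordinates on the right `K`-space `D ^ n`. -/
def RightIso.toLinearEquiv {n m : ℕ} (g : RightIso K n m) :
    (Fin n → RightScalar j) ≃ₗ[K] (Fin m → K) where
  toFun v := g.toAddEquiv fun i => toD j (v i)
  invFun w i := (toD j).symm (g.toAddEquiv.symm w i)
  left_inv v := by simp
  right_inv w := by simp
  map_add' v w := by
    rw [← map_add]
    congr 1
  map_smul' k v := by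
    have h := g.map_mul_right' (fun i => toD j (v i)) k
    have h' : (fun i => toD j ((k • v) i)) = fun i => toD j (v i) * (k : D) := by
      funext i
      simp [hj]
    rw [h']
    refine h.trans ?_
    funext i
    exact mul_comm _ _

include hj in
theorem RightIso.charPoly_eq {n m : ℕ} [FiniteDimensional F D] (g : RightIso K n m)
    (A : Matrix (Fin n) (Fin n) D) :
    g.charPoly A = (-1) ^ m * (matrixEnd j A).charpoly := by
  have hM : g.toMatrix A =
      LinearMap.toMatrix' ((g.toLinearEquiv j hj).conj (matrixEnd j A)) := by
    ext a b
    rw [LinearMap.toMatrix'_apply]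
    rfl
  have hA : (matrixEnd j A).charpoly = (g.toMatrix A).charpoly := by
    rw [← LinearEquiv.charpoly_conj (g.toLinearEquiv j hj), hM, ← LinearMap.charpoly_toMatrix _
      (Pi.basisFun K (Fin m))]
    rfl
  rw [hA, Matrix.charpoly]
  have hneg : (g.toMatrix A).map (fun a => (Polynomial.C a : Polynomial K)) -
      (Polynomial.X : Polynomial K) • (1 : Matrix (Fin m) (Fin m) (Polynomial K)) =
      -(g.toMatrix A).charmatrix := by
    ext1 a b
    by_cases h : a = b
    · subst h; simp
    · simp [h]
  rw [RightIso.charPoly, hneg, Matrix.det_neg, Fintype.card_fin]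

end Coordinates

variable [FiniteDimensional F D] [Algebra.IsCentral F D] {d : ℕ}

/-- The facts about a maximal subfield `K` in terms of the characteristic polynomial over the
centre. -/
theorem IsMaximalSubfield.spec (hK : IsMaximalSubfield K) (hd : Module.finrank F D = d ^ 2)
    (hd0 : d ≠ 0) (n : ℕ) :
    Nonempty (RightIso K n (n * d)) ∧
    ∀ (A : Matrix (Fin n) (Fin n) D) (P : Polynomial F), P.Monic →
      P ^ d = (A.mulVecEnd F).charpoly →
      (∀ g : RightIso K n (n * d), (g.charPoly A).map K.subtype =
        ((-1) ^ (n * d) * P).map (algebraMap F D)) ∧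
      ∀ l ∈ K, IsRightEigenvalue A l ↔ Polynomial.aeval l P = 0 := by
  let _ : Algebra F K := ((algebraMap F D).codRestrict K fun c => hK.algebraMap_mem c).toAlgebra
  let j : K →ₐ[F] D := { K.subtype with commutes' := fun c => rfl }
  have hj : ∀ k, j k = k := fun k => rfl
  have : FiniteDimensional F K :=
    FiniteDimensional.of_injective j.toLinearMap Subtype.val_injective
  have hE : Subalgebra.centralizer F (Set.range j) = j.range := by
    refine le_antisymm (fun x hx => ?_) ?_
    · exact ⟨⟨x, hK.mem_of_commute fun k hk => hx k ⟨⟨k, hk⟩, rfl⟩⟩, rfl⟩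
    · rintro _ ⟨a, rfl⟩ _ ⟨b, rfl⟩
      exact congrArg Subtype.val (mul_comm b a)
  have hdim := finrank_pi_rightScalar j hd hE n
  refine ⟨⟨RightIso.ofLinearEquiv j hj (LinearEquiv.ofFinrankEq _ _ (by simp [hdim]))⟩, ?_⟩
  intro A P hP hPd
  -- Uniqueness of monic `d`-th roots: this is the independence of `K` and of the coordinates.
  have hchar : (matrixEnd j A).charpoly = P.map (algebraMap F K) := by
    refine (LinearMap.charpoly_monic _).eq_of_pow_eq_pow (hP.map _) hd0 ?_
    rw [← charpoly_mulVecEnd_map j hd hE, ← hPd, Polynomial.map_pow]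
  constructor
  · intro g
    have h : g.charPoly A = ((-1) ^ (n * d) * P).map (algebraMap F K) := by
      rw [g.charPoly_eq j hj, hchar]
      simp
    rw [h, Polynomial.map_map]
    rfl
  · intro l hl
    have hev : IsRightEigenvalue A l ↔ (matrixEnd j A).HasEigenvalue ⟨l, hl⟩ := by
      constructor
      · rintro ⟨v, hv, hAv⟩
        refine Module.End.hasEigenvalue_of_hasEigenvector
          (x := fun i => (toD j).symm (v i)) (Module.End.hasEigenvector_iff.2 ⟨?_, fun h => hv ?_⟩)
        · refine Module.End.mem_eigenspace_iff.2 ?_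
          funext i
          apply (toD j).injective
          simp [hj, hAv]
        · funext i
          exact congrFun h i
      · intro h
        obtain ⟨v, hv⟩ := h.exists_hasEigenvector
        refine ⟨fun i => toD j (v i), fun h0 => hv.2 ?_, ?_⟩
        · funext i
          exact congrFun h0 i
        · funext i
          have := congrArg (fun w => toD j (w i)) hv.apply_eq_smul
          simpa [hj] using this
    rw [hev, Module.End.hasEigenvalue_iff_isRoot_charpoly, hchar, Polynomial.IsRoot.def,
      Polynomial.eval_map_algebraMap, ← map_eq_zero_iff j Subtype.val_injective,
      ← Polynomial.aeval_algHom_apply, hj]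

end MaximalSubfield

theorem theorem1 {F : Type*} {D : Type*} [Field F] [DivisionRing D] [Algebra F D]
    [Algebra.IsCentral F D] [FiniteDimensional F D] (d n : ℕ)
    (hd : Module.finrank F D = d ^ 2) (hn : 0 < n) (A : Matrix (Fin n) (Fin n) D) :
    (∃ K : Subfield D, IsMaximalSubfield K) ∧
    (∀ K : Subfield D, IsMaximalSubfield K → Nonempty (RightIso K n (n * d))) ∧
    ∃ Φ : Polynomial F,
      (∀ (K : Subfield D) [IsMulCommutative K], IsMaximalSubfield K →
        ∀ g : RightIso K n (n * d),
          (g.charPoly A).map K.subtype = Φ.map (algebraMap F D)) ∧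
      ∀ l : D, IsRightEigenvalue A l ↔ Polynomial.aeval l Φ = 0 := by
  have hd0 : d ≠ 0 := by
    rintro rfl
    have : 0 < Module.finrank F D := Module.finrank_pos
    simp [hd] at this
  obtain ⟨P, hP, hPd⟩ := exists_monic_pow_eq_charpoly_mulVecEnd hd hd0 A
  refine ⟨(exists_isMaximalSubfield_mem (0 : D)).imp fun _ h => h.1, fun K hK => ?_,
    -- The sign passes from `det (z I - f(A))` to `det (f(A) - z I)`.
    (-1) ^ (n * d) * P, fun K _ hK => ?_, fun l => ?_⟩
  · have := hK.prop
    exact (hK.spec hd hd0 n).1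
  · exact ((hK.spec hd hd0 n).2 A P hP hPd).1
  · obtain ⟨K, hK, hl⟩ := exists_isMaximalSubfield_mem l
    have := hK.prop
    rw [((hK.spec hd hd0 n).2 A P hP hPd).2 l hl]
    simp
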